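/- Let $\mathcal A$ be a unital $C^*$-algebra, let $\mathcal B\subseteq\mathscr B(\mathcal H)$ and $\mathcal C\subseteq\mathscr B(\mathcal H')$ be von Neumann algebras on complex Hilbert spaces, and let $\xi:\mathcal B\to\mathcal C$ be a nonzero normal completely positive (CP) map (normal: $\xi$ preserves suprema of bounded increasing nets of self-adjoint elements). Put $\mathcal N_\xi=\{X\in\mathcal B:\xi(X^*X)=0\}$. A minimal Stinespring triple of a CP map $\varphi:\mathcal A\to\mathcal B\subseteq\mathscr B(\mathcal H)$ is a triple $(\mathcal K,\pi,V)$ consisting of a Hilbert space $\mathcal K$, a unital $*$-representation $\pi:\mathcal A\to\mathscr B(\mathcal K)$ and a bounded operator $V:\mathcal H\to\mathcal K$ such that $\varphi(X)=V^*\pi(X)V$ for all $X\in\mathcal A$ and $\overline{\operatorname{span}}\{\pi(X)Vh: X\in\mathcal A,\ h\in\mathcal H\}=\mathcal K$; it is unique up to unitary equivalence. The map $\varphi$ is called quasi-pure if every nonzero vector $g$ in the range of $V$ is cyclic for $\pi$, that is, $\overline{\operatorname{span}}\{\pi(X)g:X\in\mathcal A\}=\mathcal K$. Let $\varphi,\psi:\mathcal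 A\to\mathcal B$ be CP maps such that 1. $\varphi$ is quasi-pure, 2. $\xi\circ\varphi\neq 0$, 3. $\varphi(I)=\psi(I)$, 4. $\varphi$ and $\psi$ are equal almost everywhere with respect to $\xi$, that is, $\varphi(X)-\psi(X)\in\mathcal N_\xi$ for every $X\in\mathcal A$. Then $\varphi=\psi$. -/

import Mathlib

open scoped CStarAlgebra

namespace VonNeumannAlgebra

variable {H : Type*} [NormedAddCommGroup H] [InnerProductSpace ℂ H] [CompleteSpace H]

instance instSMulMemClass : SMulMemClass (VonNeumannAlgebra H) ℂ (H →L[ℂ] H) where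
  smul_mem {S} c _ hx := S.toStarSubalgebra.smul_mem hx c

/-- A von Neumann algebra, being a commutant, is norm closed. -/
theorem isClosed_coe (B : VonNeumannAlgebra H) : IsClosed (B : Set (H →L[ℂ] H)) := by
  rw [← B.centralizer_centralizer]
  exact Set.isClosed_centralizer _

/-- A von Neumann algebra on `H` is a (unital) C⋆-algebra, with the operations and the norm
inherited from the bounded operators on `H`. -/
noncomputable instance instCStarAlgebra (B : VonNeumannAlgebra H) : CStarAlgebra B :=
  StarSubalgebra.cstarAlgebra B (h_closed := B.isClosed_coe)

/-- The order inherited from the Loewner order on the bounded operators on `H` is the usual order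
of the C⋆-algebra `B`: the positive elements are the (sums of) elements `star s * s`, `s ∈ B`. -/
instance instStarOrderedRing (B : VonNeumannAlgebra H) : StarOrderedRing B :=
  StarOrderedRing.of_nonneg_iff' (fun {x y} hxy z => add_le_add_right (α := H →L[ℂ] H) hxy z)
    (fun x => by
      constructor
      · intro hx
        have hx' : (0 : H →L[ℂ] H) ≤ (x : H →L[ℂ] H) := hx
        have hmem : CFC.sqrt (x : H →L[ℂ] H) ∈ B := by
          rw [← SetLike.mem_coe, ← B.centralizer_centralizer]
          refine Set.mem_centralizer_iff.mpr fun m hm => ?_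
          have hc : Commute (x : H →L[ℂ] H) m := Set.mem_centralizer_iff.mp hm x x.2
          exact (hc.cfcₙ_nnreal NNReal.sqrt).symm.eq
        refine ⟨⟨CFC.sqrt (x : H →L[ℂ] H), hmem⟩, Subtype.ext ?_⟩
        change (x : H →L[ℂ] H) = star (CFC.sqrt (x : H →L[ℂ] H)) * CFC.sqrt (x : H →L[ℂ] H)
        rw [(CFC.sqrt_nonneg (x : H →L[ℂ] H)).isSelfAdjoint.star_eq,
          CFC.sqrt_mul_sqrt_self (x : H →L[ℂ] H) hx']
      · rintro ⟨s, rfl⟩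
        exact star_mul_self_nonneg (s : H →L[ℂ] H))

end VonNeumannAlgebra

/-- A positive linear map `ξ` between von Neumann algebras is *normal* if it preserves least upper
bounds of (nonempty) bounded upward directed sets of self-adjoint elements. -/
def IsNormalMap {H H' : Type*} [NormedAddCommGroup H] [InnerProductSpace ℂ H] [CompleteSpace H]
    [NormedAddCommGroup H'] [InnerProductSpace ℂ H'] [CompleteSpace H']
    {B : VonNeumannAlgebra H} {C : VonNeumannAlgebra H'} (ξ : B →CP C) : Prop :=
  ∀ (D : Set B) (b : B), D.Nonempty → DirectedOn (· ≤ ·) D → (∀ d ∈ D, IsSelfAdjoint d) →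
    IsLUB D b → IsLUB (ξ '' D) (ξ b)

/-- The null ideal `{X | ξ (X⋆ X) = 0}` of a completely positive map, as a set. -/
def nullIdeal {B C : Type*} [CStarAlgebra B] [PartialOrder B] [StarOrderedRing B]
    [CStarAlgebra C] [PartialOrder C] [StarOrderedRing C] (ξ : B →CP C) : Set B :=
  {X | ξ (star X * X) = 0}

/-- `φ` and `ψ` are equal almost everywhere with respect to `ξ`: the difference `φ X - ψ X` lies
in the null ideal of `ξ` for every `X`. -/
def EqualAE {A B C : Type*} [CStarAlgebra A] [PartialOrder A] [StarOrderedRing A]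
    [CStarAlgebra B] [PartialOrder B] [StarOrderedRing B]
    [CStarAlgebra C] [PartialOrder C] [StarOrderedRing C]
    (ξ : B →CP C) (φ ψ : A →CP B) : Prop :=
  ∀ X : A, φ X - ψ X ∈ nullIdeal ξ

/-- `g` is a cyclic vector of the representation `π`: the closed linear span of
`{π X g | X ∈ A}` is the whole space. -/
def IsCyclicVector {A K : Type*} [CStarAlgebra A]
    [NormedAddCommGroup K] [InnerProductSpace ℂ K] [CompleteSpace K]
    (π : A →⋆ₐ[ℂ] (K →L[ℂ] K)) (g : K) : Prop :=
  (Submodule.span ℂ (Set.range fun X : A => π X g)).topologicalClosure = ⊤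

/-- `(K, π, V)`, with `π` a unital ⋆-representation of `A` on `K`, is a minimal Stinespring triple
of the map `φ` from `A` to the bounded operators on `H`: `φ X = V⋆ (π X) V` for all `X`, and the
closed linear span of `{π X (V h) | X ∈ A, h ∈ H}` is `K`. -/
structure IsMinimalStinespring {A H K : Type*} [CStarAlgebra A]
    [NormedAddCommGroup H] [InnerProductSpace ℂ H] [CompleteSpace H]
    [NormedAddCommGroup K] [InnerProductSpace ℂ K] [CompleteSpace K]
    (φ : A → (H →L[ℂ] H)) (π : A →⋆ₐ[ℂ] (K →L[ℂ] K)) (V : H →L[ℂ] K) : Prop where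
  eq_dilation : ∀ X : A, φ X = (ContinuousLinearMap.adjoint V).comp ((π X).comp V)
  minimal : (Submodule.span ℂ
    (Set.range fun p : A × H => π p.1 (V p.2))).topologicalClosure = ⊤

/-- A completely positive map `φ` into a von Neumann algebra on `H`, viewed as a map into the
bounded operators on `H`, is *quasi-pure* if in its minimal Stinespring triple `(K, π, V)` every
nonzero vector in the range of `V` is cyclic for `π`.  Minimal Stinespring triples exist in the
universe below and are unique up to unitary equivalence, so the choice of the triple does not
matter. -/
def IsQuasiPure.{u, v} {A : Type u} [CStarAlgebra A] [PartialOrder A] [StarOrderedRing A]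
    {H : Type v} [NormedAddCommGroup H] [InnerProductSpace ℂ H] [CompleteSpace H]
    {B : VonNeumannAlgebra H} (φ : A →CP B) : Prop :=
  ∃ (K : Type (max u v)) (_ : NormedAddCommGroup K) (_ : InnerProductSpace ℂ K)
    (_ : CompleteSpace K) (π : A →⋆ₐ[ℂ] (K →L[ℂ] K)) (V : H →L[ℂ] K),
    IsMinimalStinespring (fun X => (φ X : H →L[ℂ] H)) π V ∧
      ∀ g ∈ Set.range V, g ≠ 0 → IsCyclicVector π g

/-! Let `P` be the cone of positive `x` in `B` with `ξ x = 0`, and `p` the projection onto the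
orthogonal complement of its common kernel. The elements `a (1 + a)⁻¹`, `a ∈ P`, increase to `p` and
are killed by `ξ`, so normality gives `ξ p = 0` (`apply_supportProjection_nullCone`). If `V`
vanished on the common kernel, then `φ 1 = V⋆V ≤ ‖φ 1‖ p`, hence `ξ (φ 1) = 0` and `ξ ∘ φ = 0`, a
contradiction. So some `h` in the common kernel has `V h ≠ 0`, a cyclic vector by quasi-purity.
Almost everywhere equality puts `|φ X - ψ X|²` in `P`, so `φ X h = ψ X h` for all `X`.

Agreement at `h` and at `1` then forces `φ = ψ` (`eq_of_isCyclicVector`): complete positivity of `ψ`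
bounds its deviation from `φ` at `k` by the distance from `V k` to the orbit of `V h`, which is
zero. -/

section

open scoped NNReal InnerProductSpace
open CFC


/-! ### Resolvent approximate units -/

section ApproximateUnit

variable {A : Type*} [CStarAlgebra A] [PartialOrder A] [StarOrderedRing A]

/-- The element `a (1 + a)⁻¹` attached to a positive element `a`. -/
noncomputable def resolventUnit (a : A) : A := cfcₙ (fun x : ℝ≥0 ↦ 1 - (1 + x)⁻¹) a

theorem resolventUnit_nonneg (a : A) : 0 ≤ resolventUnit a := cfcₙ_nonneg_of_predicate

theorem norm_resolventUnit_le_one (a : A) : ‖resolventUnit a‖ ≤ 1 :=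
  (norm_cfcₙ_one_sub_one_add_inv_lt_one a).le

theorem resolventUnit_le_one (a : A) : resolventUnit a ≤ 1 :=
  (CStarAlgebra.norm_le_one_iff_of_nonneg _ (resolventUnit_nonneg a)).mp
    (norm_resolventUnit_le_one a)

theorem resolventUnit_mono {a b : A} (ha : 0 ≤ a) (hab : a ≤ b) :
    resolventUnit a ≤ resolventUnit b :=
  CFC.monotoneOn_one_sub_one_add_inv ha (ha.trans hab) hab

theorem continuous_one_sub_one_add_inv : Continuous fun x : ℝ≥0 ↦ 1 - (1 + x)⁻¹ := by
  fun_prop (disch := intro _; positivity)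

theorem continuousOn_one_sub_one_add_inv (s : Set ℝ≥0) :
    ContinuousOn (fun x : ℝ≥0 ↦ 1 - (1 + x)⁻¹) s :=
  continuous_one_sub_one_add_inv.continuousOn

theorem resolventUnit_add_mul (a : A) (ha : 0 ≤ a) :
    resolventUnit a + resolventUnit a * a = a := by
  have hc := continuousOn_one_sub_one_add_inv (quasispectrum ℝ≥0 a)
  unfold resolventUnit
  conv_rhs => rw [← cfcₙ_id' ℝ≥0 a]
  have h : cfcₙ (fun x : ℝ≥0 ↦ 1 - (1 + x)⁻¹) a * a =
      cfcₙ (fun x : ℝ≥0 ↦ (1 - (1 + x)⁻¹) * x) a := by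
    rw [cfcₙ_mul _ _ a (by fun_prop) (by simp) (by fun_prop) (by simp), cfcₙ_id' ℝ≥0 a]
  rw [h]
  refine (cfcₙ_add (R := ℝ≥0) (a := a) (fun x : ℝ≥0 ↦ 1 - (1 + x)⁻¹)
    (fun x : ℝ≥0 ↦ (1 - (1 + x)⁻¹) * x) (by fun_prop) (by simp) (by fun_prop) (by simp)).symm.trans ?_
  refine cfcₙ_congr fun x _ ↦ ?_
  have h1 : (1 + x)⁻¹ ≤ 1 := inv_le_one_of_one_le₀ (by simp)
  ext
  have h2 : (1 + (x : ℝ)) ≠ 0 := by positivity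
  simp only [NNReal.coe_add, NNReal.coe_mul, NNReal.coe_sub h1, NNReal.coe_one, NNReal.coe_inv]
  field_simp
  ring

theorem resolventUnit_le_self (a : A) (ha : 0 ≤ a) : resolventUnit a ≤ a := by
  unfold resolventUnit
  conv_rhs => rw [← cfcₙ_id' ℝ≥0 a]
  have hc := continuousOn_one_sub_one_add_inv (quasispectrum ℝ≥0 a)
  refine cfcₙ_mono (fun x _ ↦ ?_) (by fun_prop) (by fun_prop)
  have h1 : (1 + x)⁻¹ ≤ 1 := inv_le_one_of_one_le₀ (by simp)
  rw [← NNReal.coe_le_coe, NNReal.coe_sub h1]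
  have h2 : 0 < (1 + (x : ℝ)) := by positivity
  simp only [NNReal.coe_add, NNReal.coe_one, NNReal.coe_inv]
  have h3 : 1 - (1 + (x : ℝ))⁻¹ = x / (1 + x) := by field_simp; ring
  rw [h3]
  exact div_le_self x.2 (by simp)

/-- With `r = resolventUnit (n • a)`, the identity `r + r (n a) = n a` says `n (a - r a) = r`, and
`‖r‖ ≤ 1`. -/
theorem norm_sub_resolventUnit_nsmul_mul_le (a : A) (ha : 0 ≤ a) (n : ℕ) :
    n * ‖a - resolventUnit (n • a) * a‖ ≤ 1 := by
  have h := resolventUnit_add_mul (n • a) (nsmul_nonneg ha n)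
  have h2 : n • (a - resolventUnit (n • a) * a) = resolventUnit (n • a) := by
    rw [smul_sub, ← mul_smul_comm, sub_eq_iff_eq_add, h]
  calc n * ‖a - resolventUnit (n • a) * a‖ = ‖n • (a - resolventUnit (n • a) * a)‖ := by
        rw [← Nat.cast_smul_eq_nsmul ℝ n (a - _), norm_smul, Real.norm_natCast]
    _ ≤ 1 := by rw [h2]; exact norm_resolventUnit_le_one _

end ApproximateUnit

/-! ### Complete positivity as positivity of sesquilinear sums -/

section CompletelyPositive

variable {A : Type*} [CStarAlgebra A] [PartialOrder A] [StarOrderedRing A]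
  {H : Type*} [NormedAddCommGroup H] [InnerProductSpace ℂ H] [CompleteSpace H]
  {B : VonNeumannAlgebra H}

theorem CStarMatrix.re_sum_inner_nonneg {n : Type*} [Fintype n] (M : CStarMatrix n n B)
    (hM : 0 ≤ M) (v : n → H) :
    0 ≤ (∑ i, ∑ j, ⟪v i, (M i j : H →L[ℂ] H) (v j)⟫_ℂ).re := by
  rw [StarOrderedRing.nonneg_iff] at hM
  induction hM using AddSubmonoid.closure_induction with
  | zero => simp
  | add M₁ M₂ _ _ h₁ h₂ =>
    simp only [CStarMatrix.add_apply, AddMemClass.coe_add, _root_.add_apply,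
      inner_add_right, Finset.sum_add_distrib, Complex.add_re]
    exact add_nonneg h₁ h₂
  | mem M hM =>
  obtain ⟨N, rfl⟩ := hM
  dsimp only
  have key : ∑ i, ∑ j, ⟪v i, ((star N * N) i j : H →L[ℂ] H) (v j)⟫_ℂ =
      ∑ k, ⟪∑ i, (N k i : H →L[ℂ] H) (v i), ∑ j, (N k j : H →L[ℂ] H) (v j)⟫_ℂ := by
    simp only [sum_inner, inner_sum]
    have h (i j : n) : ⟪v i, ((star N * N) i j : H →L[ℂ] H) (v j)⟫_ℂ =
        ∑ k, ⟪(N k i : H →L[ℂ] H) (v i), (N k j : H →L[ℂ] H) (v j)⟫_ℂ := by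
      have h1 : ((star N * N) i j : H →L[ℂ] H) =
          ∑ k, ContinuousLinearMap.adjoint (N k i : H →L[ℂ] H) * (N k j : H →L[ℂ] H) := by
        rw [CStarMatrix.mul_apply, AddSubmonoidClass.coe_finsetSum]
        rfl
      rw [h1, _root_.sum_apply, inner_sum]
      simp [ContinuousLinearMap.adjoint_inner_right]
    simp only [h]
    conv_lhs => enter [2, i]; rw [Finset.sum_comm]
    rw [Finset.sum_comm]
    refine Finset.sum_congr rfl fun k _ ↦ Finset.sum_comm
  rw [key, Complex.re_sum]
  exact Finset.sum_nonneg fun k _ ↦ inner_self_nonneg (𝕜 := ℂ)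

theorem CompletelyPositiveMap.re_sum_inner_nonneg (ψ : A →CP B) {n : Type*} [Fintype n]
    (a : n → A) (v : n → H) :
    0 ≤ (∑ i, ∑ j, ⟪v i, (ψ (star (a i) * a j) : H →L[ℂ] H) (v j)⟫_ℂ).re := by
  rcases isEmpty_or_nonempty n with h | ⟨⟨i₀⟩⟩
  · simp
  classical
  -- A single nonzero row, placed at `i₀`, makes the Gram matrix `star (a i) * a j` equal to `star N
  -- * N`.
  let N : CStarMatrix n n A := CStarMatrix.ofMatrix fun i j ↦ if i = i₀ then a j else 0
  have hN : star N * N = CStarMatrix.ofMatrix fun i j ↦ star (a i) * a j := by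
    ext i j
    rw [CStarMatrix.mul_apply]
    simp only [N, CStarMatrix.star_apply]
    change ∑ k, star (if k = i₀ then a i else 0) * (if k = i₀ then a j else 0) = star (a i) * a j
    simp
  have h := CStarMatrix.re_sum_inner_nonneg _ (ψ.map_cstarMatrix_nonneg _ (star_mul_self_nonneg N)) v
  rw [hN] at h
  exact h

end CompletelyPositive

/-! ### Rigidity at a cyclic vector -/

section Dilation

variable {A : Type*} [CStarAlgebra A] [PartialOrder A] [StarOrderedRing A]
  {H : Type*} [NormedAddCommGroup H] [InnerProductSpace ℂ H] [CompleteSpace H]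
  {K : Type*} [NormedAddCommGroup K] [InnerProductSpace ℂ K] [CompleteSpace K]
  {B : VonNeumannAlgebra H}

/-- The orbit of `g` is already a linear subspace, being the range of `X ↦ π X g`, so it is itself
dense. -/
theorem IsCyclicVector.induction {A : Type*} [CStarAlgebra A] {π : A →⋆ₐ[ℂ] (K →L[ℂ] K)}
    {g : K} (hg : IsCyclicVector π g)
    {p : K → Prop} (hp : IsClosed {u | p u}) (h : ∀ X : A, p (π X g)) (u : K) : p u := by
  let T : A →ₗ[ℂ] K := (ContinuousLinearMap.apply ℂ K g).toLinearMap ∘ₗ π.toAlgHom.toLinearMap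
  have hT : Submodule.span ℂ (Set.range fun X : A ↦ π X g) = LinearMap.range T := by
    rw [← Submodule.span_eq (LinearMap.range T)]
    rfl
  have hu : u ∈ closure (LinearMap.range T : Set K) := by
    rw [← Submodule.topologicalClosure_coe, ← hT, hg]
    trivial
  refine closure_minimal ?_ hp hu
  rintro _ ⟨X, rfl⟩
  exact h X

theorem eq_zero_of_forall_re_mul_nonneg {z : ℂ} {r : ℝ}
    (h : ∀ c : ℂ, 0 ≤ 2 * (c * z).re + ‖c‖ ^ 2 * r) : z = 0 := by
  by_contra hz
  have hz' : 0 < ‖z‖ ^ 2 := by positivity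
  have hr : 0 < |r| + 1 := by positivity
  -- For `c = -t * conj z` with `t = 1 / (|r| + 1)`, the linear term `-2t‖z‖²` beats the quadratic
  -- one, as `t r ≤ 1`.
  have h1 := h (-((|r| + 1)⁻¹ : ℝ) * (starRingEnd ℂ) z)
  have h2 : (-((|r| + 1)⁻¹ : ℝ) * (starRingEnd ℂ) z * z).re = -((|r| + 1)⁻¹ * ‖z‖ ^ 2) := by
    rw [mul_assoc, Complex.conj_mul', ← Complex.ofReal_neg, ← Complex.ofReal_pow,
      ← Complex.ofReal_mul, Complex.ofReal_re, neg_mul]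
  have h3 : ‖-((|r| + 1)⁻¹ : ℝ) * (starRingEnd ℂ) z‖ = (|r| + 1)⁻¹ * ‖z‖ := by
    rw [norm_mul, norm_neg, Complex.norm_real, Real.norm_of_nonneg (by positivity),
      RCLike.norm_conj]
  rw [h2, h3] at h1
  have h4 : (|r| + 1)⁻¹ * r ≤ 1 := by
    rw [inv_mul_le_iff₀ hr]
    linarith [le_abs_self r]
  have h5 : 0 < (|r| + 1)⁻¹ * ‖z‖ ^ 2 := by positivity
  nlinarith

/-- A completely positive map is determined by its value at `1` and its values at a vector that a
dilation of the map sends to a cyclic vector. -/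
theorem eq_of_isCyclicVector {φ ψ : A →CP B} {π : A →⋆ₐ[ℂ] (K →L[ℂ] K)} {V : H →L[ℂ] K}
    (hV : ∀ X : A, (φ X : H →L[ℂ] H) = (ContinuousLinearMap.adjoint V).comp ((π X).comp V))
    (hone : φ 1 = ψ 1) {h : H} (hg : IsCyclicVector π (V h))
    (heq : ∀ X : A, (φ X : H →L[ℂ] H) h = (ψ X : H →L[ℂ] H) h) : φ = ψ := by
  have hφ (X : A) (k l : H) : ⟪k, (φ X : H →L[ℂ] H) l⟫_ℂ = ⟪V k, π X (V l)⟫_ℂ := by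
    rw [hV]
    simp [ContinuousLinearMap.adjoint_inner_right]
  have hψ (X : A) (k l : H) :
      ⟪k, (ψ (star X) : H →L[ℂ] H) l⟫_ℂ = (starRingEnd ℂ) ⟪l, (ψ X : H →L[ℂ] H) k⟫_ℂ := by
    rw [map_star, inner_conj_symm]
    exact ContinuousLinearMap.adjoint_inner_right _ _ _
  have hπ (X : A) (u v : K) : ⟪u, π (star X) v⟫_ℂ = ⟪π X u, v⟫_ℂ := by
    rw [map_star]
    exact ContinuousLinearMap.adjoint_inner_right _ _ _
  have hone' : (φ 1 : H →L[ℂ] H) = ψ 1 := by rw [hone]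
  refine DFunLike.ext _ _ fun Y ↦ Subtype.ext <| ContinuousLinearMap.ext fun k ↦
    ext_inner_left ℂ fun l ↦ ?_
  -- For `u = π X (V h)` this is positivity of `ψ` on three vectors; every term involving `h`, and
  -- the `(k, k)` term, can be computed from `φ`. Density of the orbit gives all `u`.
  have key (c : ℂ) (u : K) : 0 ≤ ‖V k - u‖ ^ 2 +
      2 * (c * (⟪(ψ Y : H →L[ℂ] H) k, l⟫_ℂ - ⟪u, π (star Y) (V l)⟫_ℂ)).re +
      ‖c‖ ^ 2 * (⟪l, (ψ (Y * star Y) : H →L[ℂ] H) l⟫_ℂ).re := by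
    refine hg.induction (p := fun u ↦ 0 ≤ ‖V k - u‖ ^ 2 +
      2 * (c * (⟪(ψ Y : H →L[ℂ] H) k, l⟫_ℂ - ⟪u, π (star Y) (V l)⟫_ℂ)).re +
      ‖c‖ ^ 2 * (⟪l, (ψ (Y * star Y) : H →L[ℂ] H) l⟫_ℂ).re) ?_ (fun X ↦ ?_) u
    · exact isClosed_le continuous_const (by fun_prop)
    have h0 := ψ.re_sum_inner_nonneg ![1, X, star Y] ![k, -h, c • l]
    have e1 : ⟪h, (ψ (star X * X) : H →L[ℂ] H) h⟫_ℂ = ⟪π X (V h), π X (V h)⟫_ℂ := by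
      rw [← heq, hφ, map_mul, mul_apply_eq_comp, hπ]
    have e2 : ⟪l, (ψ (Y * X) : H →L[ℂ] H) h⟫_ℂ =
        (starRingEnd ℂ) ⟪π X (V h), π (star Y) (V l)⟫_ℂ := by
      rw [← heq, hφ, map_mul, mul_apply_eq_comp, inner_conj_symm, ← hπ (star Y),
        star_star]
    have e3 : ⟪h, (ψ (star X * star Y) : H →L[ℂ] H) l⟫_ℂ = ⟪π X (V h), π (star Y) (V l)⟫_ℂ := by
      rw [← star_mul, hψ, e2, Complex.conj_conj]
    have e4 : ⟪k, (ψ X : H →L[ℂ] H) h⟫_ℂ = ⟪V k, π X (V h)⟫_ℂ := by rw [← heq, hφ]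
    have e5 : ⟪h, (ψ (star X) : H →L[ℂ] H) k⟫_ℂ = (starRingEnd ℂ) ⟪V k, π X (V h)⟫_ℂ := by
      rw [hψ, e4]
    have e6 : ⟪k, (ψ 1 : H →L[ℂ] H) k⟫_ℂ = ⟪V k, V k⟫_ℂ := by
      rw [← hone', hφ]; simp
    have e7 : ⟪k, (ψ (star Y) : H →L[ℂ] H) l⟫_ℂ = ⟪(ψ Y : H →L[ℂ] H) k, l⟫_ℂ := by
      rw [hψ, inner_conj_symm]
    have e8 : ⟪l, (ψ Y : H →L[ℂ] H) k⟫_ℂ = (starRingEnd ℂ) ⟪(ψ Y : H →L[ℂ] H) k, l⟫_ℂ := by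
      rw [inner_conj_symm]
    have e9 : ‖c‖ ^ 2 = c.re * c.re + c.im * c.im := by rw [Complex.sq_norm, Complex.normSq_apply]
    simp only [Fin.sum_univ_three, Matrix.cons_val, star_one, one_mul, mul_one, map_neg, map_smul,
      inner_neg_left, inner_neg_right, inner_smul_left, inner_smul_right, star_star,
      e1, e2, e3, e4, e5, e6, e7, e8] at h0
    have e10 : ‖V k - π X (V h)‖ ^ 2 = (⟪V k, V k⟫_ℂ).re - 2 * (⟪V k, π X (V h)⟫_ℂ).re +
        (⟪π X (V h), π X (V h)⟫_ℂ).re := by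
      rw [norm_sub_sq (𝕜 := ℂ), ← inner_self_eq_norm_sq (𝕜 := ℂ), ← inner_self_eq_norm_sq (𝕜 := ℂ)]
      rfl
    rw [e10, e9]
    simp only [Complex.add_re, Complex.mul_re, Complex.neg_re, Complex.conj_re, Complex.conj_im,
      Complex.sub_re, Complex.sub_im, Complex.mul_im, Complex.neg_im] at h0 ⊢
    linarith
  -- At `u = V k` the squared distance vanishes, so the part linear in `c` must vanish too.
  have hz : ⟪(ψ Y : H →L[ℂ] H) k, l⟫_ℂ - ⟪V k, π (star Y) (V l)⟫_ℂ = 0 :=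
    eq_zero_of_forall_re_mul_nonneg fun c ↦ by simpa using key c (V k)
  rw [hφ, ← inner_conj_symm, ← inner_conj_symm l, sub_eq_zero.mp hz, hπ]

end Dilation

/-! ### Support projections as suprema of resolvent units -/

namespace VonNeumannAlgebra

variable {H : Type*} [NormedAddCommGroup H] [InnerProductSpace ℂ H] [CompleteSpace H]
  {B : VonNeumannAlgebra H}

/-- The common kernel of a set of operators in a von Neumann algebra. -/
noncomputable def commonKer (P : Set B) : Submodule ℂ H :=
  ⨅ x ∈ P, LinearMap.ker ((x : H →L[ℂ] H) : H →ₗ[ℂ] H)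

theorem mem_commonKer {P : Set B} {m : H} :
    m ∈ commonKer P ↔ ∀ x ∈ P, (x : H →L[ℂ] H) m = 0 := by
  simp [commonKer, Submodule.mem_iInf]

/-- The commutant is self-adjoint and preserves the common kernel, hence also its orthogonal
complement; the double commutant theorem applies. -/
theorem starProjection_orthogonal_commonKer_mem (P : Set B) :
    (commonKer P)ᗮ.starProjection ∈ B := by
  rw [VonNeumannAlgebra.IsStarProjection.mem_iff isStarProjection_starProjection]
  intro y hy
  rw [Submodule.range_starProjection]
  intro v hv
  rw [Submodule.mem_comap, Submodule.mem_orthogonal]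
  intro m hm
  have h1 : ContinuousLinearMap.adjoint y m ∈ commonKer P := by
    rw [mem_commonKer] at hm ⊢
    intro x hx
    have h2 := mem_commutant_iff.mp (star_mem hy) x x.2
    have h3 := congrArg (fun T : H →L[ℂ] H ↦ T m) h2
    change (x : H →L[ℂ] H) (ContinuousLinearMap.adjoint y m) = _ at h3
    rw [h3]
    change star y ((x : H →L[ℂ] H) m) = 0
    rw [hm x hx, map_zero]
  have h4 := (Submodule.mem_orthogonal _ _).mp hv _ h1
  rwa [ContinuousLinearMap.adjoint_inner_left] at h4

/-- The projection onto the orthogonal complement of the common kernel. -/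
noncomputable def supportProjection (P : Set B) : B :=
  ⟨(commonKer P)ᗮ.starProjection, starProjection_orthogonal_commonKer_mem P⟩

theorem coe_nonneg_iff {b : B} : 0 ≤ b ↔ (b : H →L[ℂ] H).IsPositive := by
  rw [← ContinuousLinearMap.nonneg_iff_isPositive]
  rfl

theorem coe_le_iff {a b : B} : a ≤ b ↔ ((b : H →L[ℂ] H) - a).IsPositive := Iff.rfl

theorem re_inner_le_of_le {a b : B} (h : a ≤ b) (k : H) :
    (⟪(a : H →L[ℂ] H) k, k⟫_ℂ).re ≤ (⟪(b : H →L[ℂ] H) k, k⟫_ℂ).re := by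
  have h1 := (coe_le_iff.mp h).re_inner_nonneg_left k
  rw [_root_.sub_apply, inner_sub_left] at h1
  simpa using h1

theorem le_of_re_inner_le {a b : B} (ha : IsSelfAdjoint a) (hb : IsSelfAdjoint b)
    (h : ∀ k : H, (⟪(a : H →L[ℂ] H) k, k⟫_ℂ).re ≤ (⟪(b : H →L[ℂ] H) k, k⟫_ℂ).re) : a ≤ b := by
  rw [coe_le_iff, ContinuousLinearMap.isPositive_def']
  refine ⟨congrArg Subtype.val (hb.sub ha), fun k ↦ ?_⟩
  rw [ContinuousLinearMap.reApplyInnerSelf_apply, _root_.sub_apply, inner_sub_left]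
  simpa using h k

theorem apply_starProjection_orthogonal {P : Set B} {b : B}
    (hb : ∀ m ∈ commonKer P, (b : H →L[ℂ] H) m = 0) (k : H) :
    (b : H →L[ℂ] H) ((commonKer P)ᗮ.starProjection k) = (b : H →L[ℂ] H) k := by
  have h : k - (commonKer P)ᗮ.starProjection k ∈ commonKer P := by
    have : (commonKer P).HasOrthogonalProjection := by
      have : IsClosed (commonKer P : Set H) := by
        have h : (commonKer P : Set H) = ⋂ x ∈ P, (x : H →L[ℂ] H) ⁻¹' {0} := by
          ext m
          simp [mem_commonKer]
        rw [h]
        exact isClosed_biInter fun x _ ↦ isClosed_singleton.preimage (ContinuousLinearMap.continuous _)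
      have := this.completeSpace_coe
      infer_instance
    rw [Submodule.starProjection_orthogonal_val, sub_sub_cancel]
    exact Submodule.starProjection_apply_mem _ _
  have h2 := hb _ h
  rw [map_sub, sub_eq_zero] at h2
  exact h2.symm

theorem re_inner_apply_eq {P : Set B} {b : B} (hs : IsSelfAdjoint b)
    (hb : ∀ m ∈ commonKer P, (b : H →L[ℂ] H) m = 0) (k : H) :
    (⟪(b : H →L[ℂ] H) k, k⟫_ℂ).re = (⟪(b : H →L[ℂ] H) ((commonKer P)ᗮ.starProjection k),
      (commonKer P)ᗮ.starProjection k⟫_ℂ).re := by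
  have hs' : ContinuousLinearMap.adjoint (b : H →L[ℂ] H) = b := congrArg Subtype.val hs
  have h (u v : H) : ⟪(b : H →L[ℂ] H) u, v⟫_ℂ = ⟪u, (b : H →L[ℂ] H) v⟫_ℂ := by
    rw [← ContinuousLinearMap.adjoint_inner_left, hs']
  rw [apply_starProjection_orthogonal hb, h k, h k, apply_starProjection_orthogonal hb]

theorem isSelfAdjoint_supportProjection (P : Set B) : IsSelfAdjoint (supportProjection P) :=
  Subtype.ext (isStarProjection_starProjection (U := (commonKer P)ᗮ)).isSelfAdjoint

theorem re_inner_supportProjection (P : Set B) (k : H) :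
    (⟪(supportProjection P : H →L[ℂ] H) k, k⟫_ℂ).re = ‖(commonKer P)ᗮ.starProjection k‖ ^ 2 := by
  change (⟪(commonKer P)ᗮ.starProjection k, k⟫_ℂ).re = _
  have h := Submodule.starProjection_inner_eq_zero (K := (commonKer P)ᗮ) k
    ((commonKer P)ᗮ.starProjection k) (Submodule.starProjection_apply_mem _ _)
  rw [inner_sub_left, sub_eq_zero] at h
  rw [← inner_conj_symm, Complex.conj_re, h]
  exact inner_self_eq_norm_sq (𝕜 := ℂ) _

/-- An operator in `B` which vanishes on the common kernel is dominated by a multiple of the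
support projection. -/
theorem le_norm_smul_supportProjection {P : Set B} {b : B} (hs : IsSelfAdjoint b)
    (hb : ∀ m ∈ commonKer P, (b : H →L[ℂ] H) m = 0) {c : ℝ} (hc : ‖(b : H →L[ℂ] H)‖ ≤ c) :
    b ≤ (c : ℂ) • supportProjection P := by
  refine le_of_re_inner_le hs ?_ fun k ↦ ?_
  · rw [IsSelfAdjoint, star_smul, (isSelfAdjoint_supportProjection P).star_eq]
    simp
  rw [re_inner_apply_eq hs hb]
  have h1 : (⟪(((c : ℂ) • supportProjection P : B) : H →L[ℂ] H) k, k⟫_ℂ).re =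
      c * ‖(commonKer P)ᗮ.starProjection k‖ ^ 2 := by
    rw [← re_inner_supportProjection]
    change (⟪(c : ℂ) • (supportProjection P : H →L[ℂ] H) k, k⟫_ℂ).re = _
    rw [inner_smul_left]
    simp
  rw [h1]
  refine (Complex.re_le_norm _).trans <| (norm_inner_le_norm _ _).trans ?_
  have h2 := (b : H →L[ℂ] H).le_of_opNorm_le hc ((commonKer P)ᗮ.starProjection k)
  calc _ ≤ c * ‖(commonKer P)ᗮ.starProjection k‖ * ‖(commonKer P)ᗮ.starProjection k‖ := by gcongr
    _ = _ := by ring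

/-- The quadratic form of `1 - a (1 + a)⁻¹`. -/
noncomputable def defect (a : B) (k : H) : ℝ := (⟪((1 - resolventUnit a : B) : H →L[ℂ] H) k, k⟫_ℂ).re

theorem isPositive_one_sub_resolventUnit (a : B) :
    ((1 - resolventUnit a : B) : H →L[ℂ] H).IsPositive :=
  coe_nonneg_iff.mp (sub_nonneg.mpr (resolventUnit_le_one a))

theorem defect_nonneg (a : B) (k : H) : 0 ≤ defect a k :=
  (isPositive_one_sub_resolventUnit a).re_inner_nonneg_left k

theorem defect_anti {a b : B} (ha : 0 ≤ a) (hab : a ≤ b) (k : H) : defect b k ≤ defect a k :=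
  re_inner_le_of_le (sub_le_sub_left (resolventUnit_mono ha hab) 1) k

theorem defect_eq (a : B) (k : H) :
    defect a k = ‖k‖ ^ 2 - (⟪((resolventUnit a : B) : H →L[ℂ] H) k, k⟫_ℂ).re := by
  change (⟪k - ((resolventUnit a : B) : H →L[ℂ] H) k, k⟫_ℂ).re = _
  rw [inner_sub_left, Complex.sub_re]
  congr 1
  exact inner_self_eq_norm_sq (𝕜 := ℂ) _

theorem defect_le (a : B) (k : H) : defect a k ≤ ‖k‖ ^ 2 := by
  rw [defect_eq, sub_le_self_iff]
  exact (coe_nonneg_iff.mp (resolventUnit_nonneg a)).re_inner_nonneg_left k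

/-- Parallelogram law for a positive quadratic form, dropping the term at `k - l`. -/
theorem defect_add_le (a : B) (k l : H) : defect a (k + l) ≤ 2 * defect a k + 2 * defect a l := by
  have h := defect_nonneg a (k - l)
  unfold defect at *
  simp only [map_add, map_sub, inner_add_left, inner_add_right, inner_sub_left, inner_sub_right,
    Complex.add_re, Complex.sub_re] at *
  linarith

theorem defect_smul (a : B) (c : ℂ) (k : H) : defect a (c • k) = ‖c‖ ^ 2 * defect a k :=
  ContinuousLinearMap.reApplyInnerSelf_smul ((1 - resolventUnit a : B) : H →L[ℂ] H) k (c := c)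

theorem nat_mul_defect_le (x : B) (hx : 0 ≤ x) (y : H) (n : ℕ) :
    n * defect (n • x) ((x : H →L[ℂ] H) y) ≤ ‖y‖ * ‖(x : H →L[ℂ] H) y‖ := by
  have h := norm_sub_resolventUnit_nsmul_mul_le x hx n
  set T : B := x - resolventUnit (n • x) * x
  have h1 : defect (n • x) ((x : H →L[ℂ] H) y) =
      (⟪(T : H →L[ℂ] H) y, (x : H →L[ℂ] H) y⟫_ℂ).re := rfl
  have h2 : defect (n • x) ((x : H →L[ℂ] H) y) ≤ ‖T‖ * ‖y‖ * ‖(x : H →L[ℂ] H) y‖ := by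
    rw [h1]
    refine (Complex.re_le_norm _).trans <| (norm_inner_le_norm _ _).trans ?_
    gcongr
    exact (T : H →L[ℂ] H).le_opNorm y
  calc n * defect (n • x) ((x : H →L[ℂ] H) y) ≤ n * (‖T‖ * ‖y‖ * ‖(x : H →L[ℂ] H) y‖) := by gcongr
    _ = (n * ‖T‖) * (‖y‖ * ‖(x : H →L[ℂ] H) y‖) := by ring
    _ ≤ 1 * (‖y‖ * ‖(x : H →L[ℂ] H) y‖) := by gcongr
    _ = _ := one_mul _

/-- The vectors which are approximated by their images under the resolvent units of a cone. -/
noncomputable def approxSubmodule (P : AddSubmonoid B) (hP : ∀ x ∈ P, 0 ≤ x) : Submodule ℂ H where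
  carrier := {k | ∀ ε > 0, ∃ a ∈ P, defect a k < ε}
  zero_mem' ε hε := ⟨0, P.zero_mem, by simpa [defect] using hε⟩
  add_mem' {k l} hk hl ε hε := by
    obtain ⟨a, ha, hak⟩ := hk (ε / 4) (by positivity)
    obtain ⟨b, hb, hbl⟩ := hl (ε / 4) (by positivity)
    -- `a + b` dominates both witnesses, and the defect is antitone.
    refine ⟨a + b, P.add_mem ha hb, ?_⟩
    have h1 := defect_anti (hP a ha) (le_add_of_nonneg_right (hP b hb)) k
    have h2 := defect_anti (hP b hb) (le_add_of_nonneg_left (hP a ha)) l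
    have h3 := defect_add_le (a + b) k l
    linarith
  smul_mem' c k hk ε hε := by
    obtain ⟨a, ha, hak⟩ := hk (ε / (‖c‖ ^ 2 + 1)) (by positivity)
    refine ⟨a, ha, ?_⟩
    rw [defect_smul]
    rw [lt_div_iff₀ (by positivity)] at hak
    nlinarith [defect_nonneg a k]

theorem isClosed_approxSubmodule (P : AddSubmonoid B) (hP : ∀ x ∈ P, 0 ≤ x) :
    IsClosed (approxSubmodule P hP : Set H) := by
  refine isClosed_of_closure_subset fun k hk ε hε ↦ ?_
  obtain ⟨l, hl, hkl⟩ := Metric.mem_closure_iff.mp hk (√(ε / 4)) (by positivity)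
  obtain ⟨a, ha, hal⟩ := hl (ε / 4) (by positivity)
  refine ⟨a, ha, ?_⟩
  have h1 := defect_add_le a l (k - l)
  rw [add_sub_cancel] at h1
  have h2 := defect_le a (k - l)
  rw [dist_eq_norm, Real.lt_sqrt (norm_nonneg _)] at hkl
  linarith

/-- The defect of `n • x` at `x y` is `O(1/n)`, so the closed approximable subspace contains `x (x
m)` for every `x ∈ P`. A vector `m` orthogonal to it thus satisfies `‖x m‖² = 0`; taking orthogonal
complements reverses the inclusion. -/
theorem orthogonal_commonKer_le_approxSubmodule (P : AddSubmonoid B) (hP : ∀ x ∈ P, 0 ≤ x) :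
    (commonKer (P : Set B))ᗮ ≤ approxSubmodule P hP := by
  have h1 : (approxSubmodule P hP)ᗮ ≤ commonKer (P : Set B) := by
    intro m hm
    rw [mem_commonKer]
    intro x hx
    have hx' : (x : H →L[ℂ] H) ((x : H →L[ℂ] H) m) ∈ approxSubmodule P hP := by
      intro ε hε
      set y := (x : H →L[ℂ] H) m
      obtain ⟨n, hn⟩ := exists_nat_gt (‖y‖ * ‖(x : H →L[ℂ] H) y‖ / ε)
      refine ⟨n • x, P.nsmul_mem hx n, ?_⟩
      have hn' : (0 : ℝ) < n := lt_of_le_of_lt (by positivity) hn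
      rw [div_lt_iff₀ hε] at hn
      have h2 := (nat_mul_defect_le x (hP x hx) y n).trans_lt hn
      exact lt_of_mul_lt_mul_left h2 hn'.le
    have h2 := (Submodule.mem_orthogonal _ _).mp hm _ hx'
    have hs : ContinuousLinearMap.adjoint (x : H →L[ℂ] H) = x :=
      congrArg Subtype.val (IsSelfAdjoint.of_nonneg (hP x hx))
    rw [← hs, ContinuousLinearMap.adjoint_inner_left, hs] at h2
    exact inner_self_eq_zero.mp h2
  have : CompleteSpace (approxSubmodule P hP) := (isClosed_approxSubmodule P hP).completeSpace_coe
  rw [← Submodule.orthogonal_orthogonal (approxSubmodule P hP)]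
  exact Submodule.orthogonal_le h1

theorem resolventUnit_apply_of_mem_commonKer {P : Set B} {a : B} (ha : a ∈ P) (hp : 0 ≤ a) {m : H}
    (hm : m ∈ commonKer P) : ((resolventUnit a : B) : H →L[ℂ] H) m = 0 := by
  have h := congrArg (fun T : B ↦ (T : H →L[ℂ] H) m) (resolventUnit_add_mul a hp)
  change ((resolventUnit a : B) : H →L[ℂ] H) m +
    ((resolventUnit a : B) : H →L[ℂ] H) ((a : H →L[ℂ] H) m) = (a : H →L[ℂ] H) m at h
  simpa [mem_commonKer.mp hm a ha] using h

/-- The support projection of a cone of positive elements is the supremum of its resolvent units. -/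
theorem isLUB_supportProjection (P : AddSubmonoid B) (hP : ∀ x ∈ P, 0 ≤ x) :
    IsLUB (resolventUnit '' (P : Set B)) (supportProjection (P : Set B)) := by
  have hsa (a : B) : IsSelfAdjoint (resolventUnit a) := .of_nonneg (resolventUnit_nonneg a)
  constructor
  · rintro _ ⟨a, ha, rfl⟩
    have h := le_norm_smul_supportProjection (P := (P : Set B)) (hsa a)
      (fun m hm ↦ resolventUnit_apply_of_mem_commonKer ha (hP a ha) hm) (c := 1)
      (norm_resolventUnit_le_one a)
    simpa using h
  · intro b hb
    have hb0 : 0 ≤ b := (resolventUnit_nonneg 0).trans (hb ⟨0, P.zero_mem, rfl⟩)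
    refine le_of_re_inner_le (isSelfAdjoint_supportProjection _) (.of_nonneg hb0) fun k ↦ ?_
    rw [re_inner_supportProjection]
    refine le_of_forall_pos_lt_add fun ε hε ↦ ?_
    obtain ⟨a, ha, hak⟩ := orthogonal_commonKer_le_approxSubmodule P hP
      (Submodule.starProjection_apply_mem _ k) ε hε
    rw [defect_eq, ← re_inner_apply_eq (hsa a)
      fun m hm ↦ resolventUnit_apply_of_mem_commonKer ha (hP a ha) hm] at hak
    have h := re_inner_le_of_le (hb ⟨a, ha, rfl⟩) k
    linarith

/-- Operator monotonicity of `t ↦ t / (1 + t)` makes the unit of `a + b` an upper bound. -/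
theorem directedOn_resolventUnit (P : AddSubmonoid B) (hP : ∀ x ∈ P, 0 ≤ x) :
    DirectedOn (· ≤ ·) (resolventUnit '' (P : Set B)) := by
  rintro _ ⟨a, ha, rfl⟩ _ ⟨b, hb, rfl⟩
  exact ⟨_, ⟨a + b, P.add_mem ha hb, rfl⟩,
    resolventUnit_mono (hP a ha) (le_add_of_nonneg_right (hP b hb)),
    resolventUnit_mono (hP b hb) (le_add_of_nonneg_left (hP a ha))⟩

end VonNeumannAlgebra

/-! ### The null cone of a normal map -/

section NullCone

variable {A C : Type*} [CStarAlgebra A] [PartialOrder A] [StarOrderedRing A]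
  [CStarAlgebra C] [PartialOrder C] [StarOrderedRing C]

/-- The positive elements that are annihilated by a completely positive map. -/
def nullCone (ξ : A →CP C) : AddSubmonoid A where
  carrier := {x | 0 ≤ x ∧ ξ x = 0}
  zero_mem' := ⟨le_rfl, map_zero ξ⟩
  add_mem' ha hb := ⟨add_nonneg ha.1 hb.1, by rw [map_add, ha.2, hb.2, add_zero]⟩

theorem CompletelyPositiveMap.eq_zero_of_le (ξ : A →CP C) {a b : A} (ha : 0 ≤ a) (hab : a ≤ b)
    (hb : ξ b = 0) : ξ a = 0 := by
  refine le_antisymm ?_ ?_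
  · rw [← hb]
    exact OrderHomClass.mono ξ hab
  · rw [← map_zero ξ]
    exact OrderHomClass.mono ξ ha

/-- Since `resolventUnit a ≤ a`, the units are killed by `ξ`; normality makes the value at their
supremum a least upper bound of `{0}`. -/
theorem apply_supportProjection_nullCone {H H' : Type*} [NormedAddCommGroup H]
    [InnerProductSpace ℂ H] [CompleteSpace H] [NormedAddCommGroup H'] [InnerProductSpace ℂ H']
    [CompleteSpace H'] {B : VonNeumannAlgebra H} {C : VonNeumannAlgebra H'} {ξ : B →CP C}
    (hξ : IsNormalMap ξ) :
    ξ (VonNeumannAlgebra.supportProjection (nullCone ξ : Set B)) = 0 := by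
  have hP : ∀ x ∈ nullCone ξ, 0 ≤ x := fun x hx ↦ hx.1
  have h := hξ (resolventUnit '' (nullCone ξ : Set B)) _ ⟨_, 0, (nullCone ξ).zero_mem, rfl⟩
    (VonNeumannAlgebra.directedOn_resolventUnit _ hP)
    (by rintro _ ⟨a, -, rfl⟩; exact .of_nonneg (resolventUnit_nonneg a))
    (VonNeumannAlgebra.isLUB_supportProjection _ hP)
  have h0 {a : B} (ha : a ∈ nullCone ξ) : ξ (resolventUnit a) = 0 :=
    ξ.eq_zero_of_le (resolventUnit_nonneg a) (resolventUnit_le_self a ha.1) ha.2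
  refine le_antisymm (h.2 ?_) (h.1 ⟨_, ⟨0, (nullCone ξ).zero_mem, rfl⟩, h0 (nullCone ξ).zero_mem⟩)
  rintro _ ⟨_, ⟨a, ha, rfl⟩, rfl⟩
  exact (h0 ha).le

/-- A positive linear map that vanishes at `1` is zero. -/
theorem LinearMap.eq_zero_of_monotone_of_map_one {C : Type*} [CStarAlgebra C] [PartialOrder C]
    (f : A →ₗ[ℂ] C) (hf : Monotone f)
    (h1 : f 1 = 0) (x : A) : f x = 0 := by
  have hs (a : A) (ha : IsSelfAdjoint a) : f a = 0 := by
    have hc : f (algebraMap ℝ A ‖a‖) = 0 := by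
      rw [Algebra.algebraMap_eq_smul_one, ← Complex.coe_smul, map_smul, h1, smul_zero]
    refine le_antisymm ?_ ?_
    · rw [← hc]
      exact hf ha.le_algebraMap_norm_self
    · have := hf ha.neg_algebraMap_norm_le_self
      rwa [map_neg, hc, neg_zero] at this
  rw [← realPart_add_I_smul_imaginaryPart x, map_add, map_smul, hs _ (realPart x).2,
    hs _ (imaginaryPart x).2, smul_zero, add_zero]

end NullCone

end

/-! ### Conclusion -/

theorem mainTheorem3 {A : Type*} [CStarAlgebra A] [PartialOrder A] [StarOrderedRing A]
    {H : Type*} [NormedAddCommGroup H] [InnerProductSpace ℂ H] [CompleteSpace H]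
    {H' : Type*} [NormedAddCommGroup H'] [InnerProductSpace ℂ H'] [CompleteSpace H']
    (B : VonNeumannAlgebra H) (C : VonNeumannAlgebra H')
    (ξ : B →CP C) (hξ_ne : ∃ b : B, ξ b ≠ 0) (hξ : IsNormalMap ξ)
    (φ ψ : A →CP B) (hφ : IsQuasiPure φ)
    (hξφ : ∃ a : A, ξ (φ a) ≠ 0) (hone : φ 1 = ψ 1) (hae : EqualAE ξ φ ψ) :
    φ = ψ := by
  obtain ⟨K, _, _, _, π, V, hV, hcyc⟩ := hφ
  obtain ⟨h, hh, hVh⟩ : ∃ h ∈ VonNeumannAlgebra.commonKer (nullCone ξ : Set B), V h ≠ 0 := by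
    by_contra! hcon
    obtain ⟨a, ha⟩ := hξφ
    have hpos : 0 ≤ φ 1 := by
      rw [← map_zero φ]
      exact OrderHomClass.mono φ zero_le_one
    -- `φ 1 = V⋆V` vanishes wherever `V` does, so the support projection dominates it up to a
    -- scalar.
    have hle := VonNeumannAlgebra.le_norm_smul_supportProjection (P := (nullCone ξ : Set B))
      (.of_nonneg hpos) (fun m hm ↦ by rw [hV.eq_dilation]; simp [hcon m hm]) le_rfl
    have h1 : ξ (φ 1) = 0 := ξ.eq_zero_of_le hpos hle (by
      rw [map_smul, apply_supportProjection_nullCone hξ, smul_zero])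
    exact ha (LinearMap.eq_zero_of_monotone_of_map_one (ξ.toLinearMap ∘ₗ φ.toLinearMap)
      (fun x y hxy ↦ OrderHomClass.mono ξ (OrderHomClass.mono φ hxy)) h1 a)
  refine eq_of_isCyclicVector hV.eq_dilation hone (hcyc _ ⟨h, rfl⟩ hVh) fun X ↦ ?_
  -- `hae X` places this positive element in the null cone, so it annihilates `h`.
  have h0 := VonNeumannAlgebra.mem_commonKer.mp hh (star (φ X - ψ X) * (φ X - ψ X))
    ⟨star_mul_self_nonneg _, hae X⟩
  set T : H →L[ℂ] H := ((φ X - ψ X : B) : H →L[ℂ] H)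
  change ContinuousLinearMap.adjoint T (T h) = 0 at h0
  have h1 : T h = 0 := by
    rw [← inner_self_eq_zero (𝕜 := ℂ), ← ContinuousLinearMap.adjoint_inner_left, h0,
      inner_zero_left]
  exact sub_eq_zero.mp h1
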